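/- Let $k$ be a field, let $P=k[x_1,\dots,x_n]$ with the standard grading, and let $L\subseteq P$ be a lexicographic ideal, that is, an ideal generated by monomials such that, whenever $u,v$ are monomials of the same degree with $v\in L$ and $u$ larger than $v$ in the lexicographic order with $x_1>\dots>x_n$, also $u\in L$. Let $$\cdots\to\bigoplus_{j}P(-j)^{\beta_{1j}}\to\bigoplus_{j}P(-j)^{\beta_{0j}}\to P/L\to 0$$ be a minimal graded free resolution of $P/L$, so that $\beta_{ij}=\beta_{ij}(P/L)$ are the graded Betti numbers of $P/L$. Let $i\ge 1$, and suppose that the sequence of Betti numbers $\beta_i=\sum_j\beta_{ij}$ admits an $i$ zero consecutive cancellation or an $i$ negative consecutive cancellation. This means that there are integers $j,j'$ with $\beta_{ij}>0$ and $\beta_{i-1,j'}>0$, where $j=j'$ for a zero cancellation and $j<j'$ for a negative one. For a monomial $m$ put $\max(m)=\max\{p : x_p \text{ divides } m\}$, with $\max(1)=0$. Then there are minimal monomial generators $m$ and $m'$ of $L$ such that 1. $\max(m)\ge i-1$; 2. $\max(m')\ge i$ and $\deg(m')<\deg(m)$. -/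

import Mathlib

open MvPolynomial

/-- `max(m)` for the monomial with exponent vector `m`: the largest `p ∈ {1, …, n}` such that the
`p`-th variable divides it. The variables are indexed by `Fin n`, so the `p`-th variable has index
`p - 1`. For the monomial `1` the value is `0`. -/
def monomialMax {n : ℕ} (m : Fin n →₀ ℕ) : ℕ :=
  m.support.sup fun p => (p : ℕ) + 1

/-- A lexicographic ideal: an ideal generated by monomials which, with every monomial, contains
every lexicographically larger monomial of the same degree (first variable largest). -/
structure IsLexIdeal {k : Type*} [Field k] {n : ℕ} (L : Ideal (MvPolynomial (Fin n) k)) :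
    Prop where
  monomial_ideal : ∃ S : Set (Fin n →₀ ℕ), L = Ideal.span ((fun s => monomial s (1 : k)) '' S)
  lex_segment : ∀ s t : Fin n →₀ ℕ, s.degree = t.degree → toLex t < toLex s →
    monomial t (1 : k) ∈ L → monomial s (1 : k) ∈ L

/-- The exponent vectors of the minimal monomial generators of a monomial ideal `L`: the monomials
of `L` that are minimal with respect to divisibility. -/
def minimalMonomialGenerators {k : Type*} [Field k] {n : ℕ}
    (L : Ideal (MvPolynomial (Fin n) k)) : Set (Fin n →₀ ℕ) :=
  {s | Minimal (fun t => monomial t (1 : k) ∈ L) s}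

/-- `v` is homogeneous of degree `j` in the graded free module `⨁ c, P(-d c)`, whose `c`-th basis
vector has degree `d c`. -/
def IsHomogeneousVector {k : Type*} [Field k] {n r : ℕ} (d : Fin r → ℕ) (j : ℕ)
    (v : Fin r → MvPolynomial (Fin n) k) : Prop :=
  ∀ c, ∀ s ∈ (v c).support, s.degree + d c = j

/-- A minimal graded free resolution
`⋯ ⟶ F 2 ⟶ F 1 ⟶ F 0 ⟶ P/I ⟶ 0` of `P/I`, where `P = k[x₁, …, xₙ]` and
`F i = ⨁ b, P(-deg i b)` has finite rank. -/
structure MinimalGradedFreeResolution {k : Type*} [Field k] {n : ℕ}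
    (I : Ideal (MvPolynomial (Fin n) k)) where
  /-- the rank of `F i` -/
  rank : ℕ → ℕ
  /-- the degrees of the basis vectors of `F i` -/
  deg : ∀ i, Fin (rank i) → ℕ
  /-- the differential `F (i + 1) ⟶ F i` -/
  diff : ∀ i, (Fin (rank (i + 1)) → MvPolynomial (Fin n) k) →ₗ[MvPolynomial (Fin n) k]
    (Fin (rank i) → MvPolynomial (Fin n) k)
  /-- the augmentation `F 0 ⟶ P/I` -/
  aug : (Fin (rank 0) → MvPolynomial (Fin n) k) →ₗ[MvPolynomial (Fin n) k]
    (MvPolynomial (Fin n) k ⧸ I)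
  diff_graded : ∀ i b, IsHomogeneousVector (deg i) (deg (i + 1) b) (diff i (Pi.single b 1))
  aug_graded : ∀ b, ∃ p : MvPolynomial (Fin n) k, p.IsHomogeneous (deg 0 b) ∧
    aug (Pi.single b 1) = Ideal.Quotient.mk I p
  aug_surjective : Function.Surjective aug
  exact_zero : Function.Exact (diff 0) aug
  exact_succ : ∀ i, Function.Exact (diff (i + 1)) (diff i)
  /-- minimality: the image of every differential lies in `(x₁, …, xₙ) • F i` -/
  minimal : ∀ i v c, diff i v c ∈ Ideal.span (Set.range (X : Fin n → MvPolynomial (Fin n) k))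

/-- The graded Betti number `β i j`: the number of copies of `P(-j)` in `F i`. -/
def MinimalGradedFreeResolution.betti {k : Type*} [Field k] {n : ℕ}
    {I : Ideal (MvPolynomial (Fin n) k)} (F : MinimalGradedFreeResolution I) (i j : ℕ) : ℕ :=
  (Finset.univ.filter fun b => F.deg i b = j).card

/-- The numbers `β i j` admit an `i` negative consecutive cancellation. -/
def AdmitsNegativeCancellation (β : ℕ → ℕ → ℕ) (i : ℕ) : Prop :=
  1 ≤ i ∧ ∃ j j' : ℕ, j < j' ∧ 0 < β i j ∧ 0 < β (i - 1) j'

/-- The numbers `β i j` admit an `i` zero consecutive cancellation. -/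
def AdmitsZeroCancellation (β : ℕ → ℕ → ℕ) (i : ℕ) : Prop :=
  1 ≤ i ∧ ∃ j j' : ℕ, j = j' ∧ 0 < β i j ∧ 0 < β (i - 1) j'

/-! Everything rests on one fact (`exists_generator_of_betti_pos`): for p ≥ 1, β_{pj} > 0 forces a
minimal generator of degree j - p + 1 with max ≥ p. Applied with p = i and, if i ≥ 2, with p = i -
1, it gives m' and m; the shift in p makes deg m' < deg m as soon as j ≤ j'.

To prove it, H_p(F ⊗ k[x_1, …, x_s]) is followed from s = 0, where minimality keeps every basis
vector alive, to s = n, where F is exact. Multiplication by x_{s+1} gives a long exact sequence, so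
a nonzero class for s yields a nonzero class for s + 1, either in the same bidegree or, through the
connecting map, with p and the degree lowered by one. The descent must therefore reach H_0, where
x_{s+1} kills a nonzero class of P/(L + later variables); the lex property turns this into a minimal
generator (`add_single_mem_minimalMonomialGenerators`). -/

/-- The ideal of `k[x₁, …, xₙ]` generated by all variables except the first `s` ones. -/
noncomputable def tailIdeal (k : Type*) [Field k] (n s : ℕ) : Ideal (MvPolynomial (Fin n) k) :=
  Ideal.span (X '' {i : Fin n | s ≤ i})

/-! ### Reduction modulo the last variables, and graded maps. -/

section Polynomial

variable {k : Type*} [Field k] {n : ℕ}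

theorem mem_tailIdeal {s : ℕ} {p : MvPolynomial (Fin n) k} :
    p ∈ tailIdeal k n s ↔ ∀ m ∈ p.support, ∃ i : Fin n, s ≤ i ∧ m i ≠ 0 := by
  simp [tailIdeal, mem_ideal_span_X_image]

theorem degree_eq_of_isHomogeneous {p : MvPolynomial (Fin n) k} {j : ℕ} (hp : p.IsHomogeneous j)
    {m : Fin n →₀ ℕ} (hm : m ∈ p.support) : m.degree = j := by
  rw [Finsupp.degree_eq_weight_one]
  exact hp (mem_support_iff.1 hm)

theorem tailIdeal_succ_le (s : ℕ) : tailIdeal k n (s + 1) ≤ tailIdeal k n s :=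
  Ideal.span_mono (Set.image_mono fun i (hi : s + 1 ≤ (i : ℕ)) => (show s ≤ (i : ℕ) by omega))

theorem X_mem_tailIdeal (a : Fin n) : (X a : MvPolynomial (Fin n) k) ∈ tailIdeal k n a :=
  Ideal.subset_span ⟨a, le_refl (a : ℕ), rfl⟩

theorem tailIdeal_zero :
    tailIdeal k n 0 = Ideal.span (Set.range (X : Fin n → MvPolynomial (Fin n) k)) := by
  simp [tailIdeal]

theorem tailIdeal_self : tailIdeal k n n = ⊥ := by
  have : {i : Fin n | n ≤ i} = ∅ := by
    ext i
    simp
  simp [tailIdeal, this]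

theorem one_notMem_tailIdeal (s : ℕ) : (1 : MvPolynomial (Fin n) k) ∉ tailIdeal k n s := by
  intro h
  obtain ⟨i, -, hi⟩ := mem_tailIdeal.1 h 0 (by simp)
  simp at hi

/-- `x_a` is a nonzerodivisor modulo the ideal generated by the later variables. -/
theorem mem_tailIdeal_of_X_mul_mem {a : Fin n} {p : MvPolynomial (Fin n) k}
    (h : X a * p ∈ tailIdeal k n (a + 1)) : p ∈ tailIdeal k n (a + 1) := by
  rw [mem_tailIdeal] at h ⊢
  intro m hm
  obtain ⟨i, hi, hmi⟩ := h (Finsupp.single a 1 + m) (by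
    rw [mem_support_iff, coeff_X_mul]
    exact mem_support_iff.1 hm)
  have hai : a ≠ i := by
    rintro rfl
    omega
  exact ⟨i, hi, by simpa [Finsupp.single_apply, hai] using hmi⟩

/-- The terms left after division by `X a` avoid x_a, so the variable witnessing membership must be
a later one. -/
theorem modMonomial_mem_tailIdeal {a : Fin n} {p : MvPolynomial (Fin n) k}
    (h : p ∈ tailIdeal k n a) :
    p.modMonomial (Finsupp.single a 1) ∈ tailIdeal k n (a + 1) := by
  rw [mem_tailIdeal] at h ⊢
  intro m hm
  rw [mem_support_iff] at hm
  have hle : ¬ Finsupp.single a 1 ≤ m := fun hle => hm (coeff_modMonomial_of_le p hle)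
  rw [coeff_modMonomial_of_not_le p hle] at hm
  obtain ⟨i, hi, hmi⟩ := h m (mem_support_iff.2 hm)
  refine ⟨i, ?_, hmi⟩
  have hai : a ≠ i := by
    rintro rfl
    exact hle (Finsupp.single_le_iff.2 (Nat.one_le_iff_ne_zero.2 hmi))
  have : (a : ℕ) ≠ i := fun h' => hai (Fin.ext h')
  omega

/-- Linear maps preserve the vectors with all coordinates in `tailIdeal k n s`. -/
theorem map_mem_tailIdeal {r r' s : ℕ}
    (f : (Fin r → MvPolynomial (Fin n) k) →ₗ[MvPolynomial (Fin n) k]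
      (Fin r' → MvPolynomial (Fin n) k))
    {v : Fin r → MvPolynomial (Fin n) k} (hv : ∀ c, v c ∈ tailIdeal k n s) (c : Fin r') :
    f v c ∈ tailIdeal k n s := by
  rw [f.pi_apply_eq_sum_univ v, Finset.sum_apply]
  exact Ideal.sum_mem _ fun b _ => Ideal.mul_mem_right _ _ (hv b)

/-- Graded maps preserve every condition on the degrees of the terms of a vector. -/
theorem forall_degree_map {r r' : ℕ} {d : Fin r → ℕ} {d' : Fin r' → ℕ}
    (f : (Fin r → MvPolynomial (Fin n) k) →ₗ[MvPolynomial (Fin n) k]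
      (Fin r' → MvPolynomial (Fin n) k))
    (hf : ∀ b, IsHomogeneousVector d' (d b) (f (Pi.single b 1))) (Q : ℕ → Prop)
    {v : Fin r → MvPolynomial (Fin n) k} (hv : ∀ c, ∀ m ∈ (v c).support, Q (m.degree + d c)) :
    ∀ c, ∀ m ∈ (f v c).support, Q (m.degree + d' c) := by
  intro c m hm
  have hsum : f v c = ∑ b, v b * f (Pi.single b 1) c := by
    conv_lhs => rw [← Finset.univ_sum_single v, map_sum, Finset.sum_apply]
    refine Finset.sum_congr rfl fun b _ => ?_
    have : (Pi.single b (v b) : Fin r → MvPolynomial (Fin n) k) = v b • Pi.single b 1 := by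
      rw [← Pi.single_smul, smul_eq_mul, mul_one]
    rw [this, map_smul, Pi.smul_apply, smul_eq_mul]
  classical
  rw [hsum] at hm
  obtain ⟨b, -, hb⟩ := Finset.mem_biUnion.1 (support_sum hm)
  obtain ⟨s, hs, t, ht, rfl⟩ := Finset.mem_add.1 (support_mul _ _ hb)
  have h1 := hv b s hs
  have h2 := hf b c t ht
  rw [← h2] at h1
  rwa [map_add, add_assoc]

/-- If a homogeneous vector lies in the image of a graded map modulo `tailIdeal k n s`, then the
preimage can be chosen homogeneous. -/
theorem exists_homogeneous_preimage {r r' s j : ℕ} {d : Fin r → ℕ} {d' : Fin r' → ℕ}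
    (f : (Fin r → MvPolynomial (Fin n) k) →ₗ[MvPolynomial (Fin n) k]
      (Fin r' → MvPolynomial (Fin n) k))
    (hf : ∀ b, IsHomogeneousVector d' (d b) (f (Pi.single b 1)))
    {w : Fin r' → MvPolynomial (Fin n) k} (hw : IsHomogeneousVector d' j w)
    {y : Fin r → MvPolynomial (Fin n) k} (hy : ∀ c, w c - f y c ∈ tailIdeal k n s) :
    ∃ z, IsHomogeneousVector d j z ∧ ∀ c, w c - f z c ∈ tailIdeal k n s := by
  classical
  -- The guard matters: for `d c > j` truncated subtraction would keep the constant term.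
  let z : Fin r → MvPolynomial (Fin n) k := fun c =>
    if d c ≤ j then homogeneousComponent (j - d c) (y c) else 0
  have hz : ∀ c m, coeff m (z c) = if m.degree + d c = j then coeff m (y c) else 0 := by
    intro c m
    simp only [z]
    split_ifs with h1 h2 h2
    · rw [coeff_homogeneousComponent, if_pos (by omega)]
    · rw [coeff_homogeneousComponent, if_neg (by omega)]
    · omega
    · simp
  have hzj : IsHomogeneousVector d j z := by
    intro c m hm
    by_contra h
    rw [mem_support_iff, hz, if_neg h] at hm
    exact hm rfl
  refine ⟨z, hzj, fun c => mem_tailIdeal.2 fun m hm => ?_⟩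
  have hr : ∀ c, ∀ m ∈ ((y - z) c).support, m.degree + d c ≠ j := by
    intro c m hm h
    rw [mem_support_iff, Pi.sub_apply, coeff_sub, hz, if_pos h, sub_self] at hm
    exact hm rfl
  -- `y - z` has no terms of degree `j`, hence neither has its image: `f y` and `f z` agree in
  -- degree `j`.
  have hfr := forall_degree_map f hf (fun l => l ≠ j) hr c m
  have hdeg : m.degree + d' c = j := by
    rcases Finset.mem_union.1 (support_sub _ _ _ hm) with h | h
    · exact hw c m h
    · exact forall_degree_map f hf (fun l => l = j) hzj c m h
  have hzero : coeff m (f (y - z) c) = 0 := by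
    by_contra h
    exact hfr (mem_support_iff.2 h) hdeg
  refine mem_tailIdeal.1 (hy c) m ?_
  rw [mem_support_iff] at hm ⊢
  rw [map_sub, Pi.sub_apply, coeff_sub, sub_eq_zero] at hzero
  rwa [coeff_sub, hzero, ← coeff_sub]

end Polynomial

/-! ### Minimal generators of lexicographic ideals. -/

section LexIdeal

variable {k : Type*} [Field k] {n : ℕ} {L : Ideal (MvPolynomial (Fin n) k)}

theorem monomial_mem_of_le {s t : Fin n →₀ ℕ} (hst : s ≤ t)
    (hs : monomial s (1 : k) ∈ L) : monomial t (1 : k) ∈ L := by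
  rw [← tsub_add_cancel_of_le hst, ← one_mul (1 : k), ← monomial_mul]
  exact Ideal.mul_mem_left _ _ hs

theorem IsLexIdeal.mem_iff (hL : IsLexIdeal L) {p : MvPolynomial (Fin n) k} :
    p ∈ L ↔ ∀ m ∈ p.support, monomial m (1 : k) ∈ L := by
  obtain ⟨S, rfl⟩ := hL.monomial_ideal
  constructor
  · intro hp m hm
    obtain ⟨s, hs, hsm⟩ := mem_ideal_span_monomial_image.1 hp m hm
    exact monomial_mem_of_le hsm (Ideal.subset_span ⟨s, hs, rfl⟩)
  · intro h
    refine mem_ideal_span_monomial_image.2 fun m hm => ?_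
    exact mem_ideal_span_monomial_image.1 (h m hm) m (by simp [mem_support_iff])

/-- If `t ∉ L` is a monomial in `x₁, …, x_a` and `x_a t ∈ L`, then `x_a t` is a minimal generator
of the lexicographic ideal `L`. -/
theorem IsLexIdeal.add_single_mem_minimalMonomialGenerators (hL : IsLexIdeal L) {a : Fin n}
    {t : Fin n →₀ ℕ} (hta : ∀ i : Fin n, (a : ℕ) + 1 ≤ i → t i = 0)
    (ht : monomial t (1 : k) ∉ L) (hat : monomial (t + Finsupp.single a 1) (1 : k) ∈ L) :
    t + Finsupp.single a 1 ∈ minimalMonomialGenerators L := by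
  refine ⟨hat, fun y hy hle p => ?_⟩
  by_contra hlt
  rw [not_le] at hlt
  have hp : Finsupp.single p 1 ≤ t + Finsupp.single a 1 :=
    Finsupp.single_le_iff.2 (by omega)
  set z := t + Finsupp.single a 1 - Finsupp.single p 1 with hz
  have hzadd : z + Finsupp.single p 1 = t + Finsupp.single a 1 := tsub_add_cancel_of_le hp
  have hzL : monomial z (1 : k) ∈ L := by
    refine monomial_mem_of_le (fun q => ?_) hy
    have hq := hle q
    have hq' := DFunLike.congr_fun hzadd q
    rw [Finsupp.add_apply] at hq'
    by_cases hpq : p = q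
    · subst hpq
      rw [Finsupp.single_eq_same] at hq'
      omega
    · rw [Finsupp.single_apply, if_neg hpq] at hq'
      omega
  by_cases hpa : p = a
  · subst hpa
    exact ht (add_right_cancel hzadd ▸ hzL)
  have hpt : t p ≠ 0 := by
    rw [Finsupp.add_apply, Finsupp.single_apply, if_neg (Ne.symm hpa)] at hlt
    omega
  have hpa' : p < a := by
    by_contra h
    refine hpt (hta p ?_)
    have : (p : ℕ) ≠ a := fun h' => hpa (Fin.ext h')
    have : ¬ (p : ℕ) < a := h
    omega
  -- Since z x_p = t x_a with p < a, `t` is lexicographically larger than `z`.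
  refine ht (hL.lex_segment t z ?_ ?_ hzL)
  · have := congrArg Finsupp.degree hzadd
    simpa using this.symm
  · refine Finsupp.Lex.lt_iff.2 ⟨p, fun q hq => ?_, ?_⟩
    · have hq' := DFunLike.congr_fun hzadd q
      simpa [Finsupp.single_apply, hq.ne', (hq.trans hpa').ne'] using hq'
    · have hp' := DFunLike.congr_fun hzadd p
      rw [Finsupp.add_apply, Finsupp.add_apply, Finsupp.single_eq_same, Finsupp.single_apply,
        if_neg (Ne.symm hpa)] at hp'
      change z p < t p
      omega

theorem le_monomialMax_add_single (a : Fin n) (t : Fin n →₀ ℕ) :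
    (a : ℕ) + 1 ≤ monomialMax (t + Finsupp.single a 1) :=
  Finset.le_sup (f := fun p : Fin n => (p : ℕ) + 1) (by simp)

end LexIdeal

/-! ### Homology of the resolution modulo the last variables. -/

namespace MinimalGradedFreeResolution

variable {k : Type*} [Field k] {n : ℕ} {L : Ideal (MvPolynomial (Fin n) k)}
  (F : MinimalGradedFreeResolution L)

theorem diff_diff (i : ℕ) (v : Fin (F.rank (i + 1 + 1)) → MvPolynomial (Fin n) k) :
    F.diff i (F.diff (i + 1) v) = 0 :=
  (F.exact_succ i _).2 ⟨v, rfl⟩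

theorem exists_aug_eq_mk {j : ℕ} {w : Fin (F.rank 0) → MvPolynomial (Fin n) k}
    (hw : IsHomogeneousVector (F.deg 0) j w) :
    ∃ q : MvPolynomial (Fin n) k, (∀ m ∈ q.support, m.degree = j) ∧
      F.aug w = Ideal.Quotient.mk L q := by
  classical
  choose p hp hpa using F.aug_graded
  refine ⟨∑ b, w b * p b, fun m hm => ?_, ?_⟩
  · obtain ⟨b, -, hb⟩ := Finset.mem_biUnion.1 (support_sum hm)
    obtain ⟨s, hs, t, ht, rfl⟩ := Finset.mem_add.1 (support_mul _ _ hb)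
    have h1 := hw b s hs
    have h2 := degree_eq_of_isHomogeneous (hp b) ht
    rw [map_add]
    omega
  · conv_lhs => rw [← Finset.univ_sum_single w, map_sum]
    rw [map_sum]
    refine Finset.sum_congr rfl fun b _ => ?_
    have : (Pi.single b (w b) : Fin (F.rank 0) → MvPolynomial (Fin n) k)
        = w b • Pi.single b 1 := by
      rw [← Pi.single_smul, smul_eq_mul, mul_one]
    rw [this, map_smul, hpa, map_mul]
    rfl

/-- A vector of `F 0` whose image in `P/L` is represented by an element of the ideal
`tailIdeal k n s` is a boundary modulo that ideal. -/
theorem exists_sub_diff_mem_of_aug_eq_mk {s : ℕ} {w : Fin (F.rank 0) → MvPolynomial (Fin n) k}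
    {q : MvPolynomial (Fin n) k} (hq : q ∈ tailIdeal k n s)
    (hw : F.aug w = Ideal.Quotient.mk L q) :
    ∃ y, ∀ c, w c - F.diff 0 y c ∈ tailIdeal k n s := by
  -- With `e` a lift of 1, `q • e` has the same image as `w` and vanishes modulo the tail ideal.
  obtain ⟨e, he⟩ := F.aug_surjective (Ideal.Quotient.mk L 1)
  have : F.aug (w - q • e) = 0 := by
    rw [map_sub, map_smul, he, hw, sub_eq_zero]
    change _ = Ideal.Quotient.mk L (q • 1)
    rw [smul_eq_mul, mul_one]
  obtain ⟨y, hy⟩ := (F.exact_zero _).1 this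
  refine ⟨y, fun c => ?_⟩
  rw [hy, Pi.sub_apply, sub_sub_cancel]
  exact Ideal.mul_mem_right _ _ hq

/-- A homogeneous vector `w` of `F 0` that is not a boundary modulo the variables after `x_a`,
while `x_a w` is, yields a minimal monomial generator. -/
theorem exists_generator_of_aug (hL : IsLexIdeal L) {a : Fin n} {j : ℕ}
    {w u : Fin (F.rank 0) → MvPolynomial (Fin n) k}
    (hw : IsHomogeneousVector (F.deg 0) j w)
    (hu : ∀ c, u c ∈ tailIdeal k n (a + 1))
    (haug : F.aug ((X a : MvPolynomial (Fin n) k) • w + u) = 0)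
    (hne : ¬ ∃ y, ∀ c, w c - F.diff 0 y c ∈ tailIdeal k n (a + 1)) :
    ∃ m ∈ minimalMonomialGenerators L, m.degree = j + 1 ∧ (a : ℕ) + 1 ≤ monomialMax m := by
  classical
  obtain ⟨q, hqj, hq⟩ := F.exists_aug_eq_mk hw
  choose p hp using fun b => Ideal.Quotient.mk_surjective (F.aug (Pi.single b 1))
  have huq : F.aug u = Ideal.Quotient.mk L (∑ b, u b * p b) := by
    conv_lhs => rw [← Finset.univ_sum_single u, map_sum]
    rw [map_sum]
    refine Finset.sum_congr rfl fun b _ => ?_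
    have : (Pi.single b (u b) : Fin (F.rank 0) → MvPolynomial (Fin n) k)
        = u b • Pi.single b 1 := by
      rw [← Pi.single_smul, smul_eq_mul, mul_one]
    rw [this, map_smul, ← hp, map_mul]
    rfl
  set u' := ∑ b, u b * p b with hu'
  have hu'mem : u' ∈ tailIdeal k n (a + 1) :=
    Ideal.sum_mem _ fun b _ => Ideal.mul_mem_right _ _ (hu b)
  have hxq : X a * q + u' ∈ L := by
    rw [← Ideal.Quotient.eq_zero_iff_mem, map_add, map_mul, ← huq, ← haug, map_add, map_smul, hq]
    rfl
  obtain ⟨t, htq, htL, hta⟩ : ∃ t ∈ q.support, monomial t (1 : k) ∉ L ∧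
      ∀ i : Fin n, (a : ℕ) + 1 ≤ i → t i = 0 := by
    -- Otherwise `q` lies in `L` plus the tail ideal, which would make `w` a boundary.
    by_contra! hcon
    have hsplit : ∀ m ∈ q.support, ∃ r ∈ tailIdeal k n (a + 1),
        monomial m (coeff m q) - r ∈ L := by
      intro m hm
      by_cases hmL : monomial m (1 : k) ∈ L
      · refine ⟨0, zero_mem _, ?_⟩
        rw [sub_zero, ← mul_one (coeff m q), ← C_mul_monomial]
        exact Ideal.mul_mem_left _ _ hmL
      · refine ⟨monomial m (coeff m q), mem_tailIdeal.2 fun m' hm' => ?_, by simp⟩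
        rw [Finset.mem_singleton.1 (support_monomial_subset hm')]
        exact hcon m hm hmL
    choose! r hr hrL using hsplit
    refine hne (F.exists_sub_diff_mem_of_aug_eq_mk (q := ∑ m ∈ q.support, r m)
      (Ideal.sum_mem _ hr) ?_)
    rw [hq, Ideal.Quotient.eq]
    nth_rw 1 [q.as_sum]
    rw [← Finset.sum_sub_distrib]
    exact Ideal.sum_mem _ hrL
  have hmem : monomial (t + Finsupp.single a 1) (1 : k) ∈ L := by
    refine hL.mem_iff.1 hxq _ ?_
    have h0 : coeff (t + Finsupp.single a 1) u' = 0 := by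
      by_contra h
      obtain ⟨i, hi, hti⟩ := mem_tailIdeal.1 hu'mem _ (mem_support_iff.2 h)
      have hai : a ≠ i := by
        rintro rfl
        omega
      simp [hta i hi, hai] at hti
    rw [mem_support_iff, coeff_add, h0, add_zero, add_comm, coeff_X_mul]
    exact mem_support_iff.1 htq
  refine ⟨_, hL.add_single_mem_minimalMonomialGenerators hta htL hmem, ?_,
    le_monomialMax_add_single a t⟩
  rw [map_add, hqj t htq, Finsupp.degree_single]

/-- Nonvanishing of the homology of `F ⊗ k[x₁, …, x_s]` in homological degree `i + 1` and internal
degree `j` forces the existence of a minimal monomial generator of degree `j - i` divisible by a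
variable of index at least `s + i + 1`. -/
theorem exists_generator_of_homology (hL : IsLexIdeal L) {s : ℕ} (hs : s ≤ n) :
    ∀ (i j : ℕ) (v : Fin (F.rank (i + 1)) → MvPolynomial (Fin n) k),
      IsHomogeneousVector (F.deg (i + 1)) j v →
      (∀ c, F.diff i v c ∈ tailIdeal k n s) →
      (¬ ∃ y, ∀ c, v c - F.diff (i + 1) y c ∈ tailIdeal k n s) →
      ∃ m ∈ minimalMonomialGenerators L, m.degree + i = j ∧ s + i + 1 ≤ monomialMax m := by
  induction hs using Nat.decreasingInduction with
  | self =>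
    intro i j v _ hcyc hbd
    have : F.diff i v = 0 := by
      funext c
      simpa [tailIdeal_self] using hcyc c
    obtain ⟨y, hy⟩ := (F.exact_succ i v).1 this
    exact absurd ⟨y, fun c => by simp [hy]⟩ hbd
  | of_succ s hs ih =>
    intro i j v hv hcyc hbd
    let a : Fin n := ⟨s, hs⟩
    -- `w` represents the image of `v` under the connecting map.
    let w : Fin (F.rank i) → MvPolynomial (Fin n) k := fun c =>
      (F.diff i v c).divMonomial (Finsupp.single a 1)
    let u : Fin (F.rank i) → MvPolynomial (Fin n) k := fun c =>
      (F.diff i v c).modMonomial (Finsupp.single a 1)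
    have hdv : F.diff i v = (X a : MvPolynomial (Fin n) k) • w + u := by
      funext c
      exact (divMonomial_add_modMonomial_single (F.diff i v c) a).symm
    have hu : ∀ c, u c ∈ tailIdeal k n (s + 1) := fun c =>
      modMonomial_mem_tailIdeal (a := a) (hcyc c)
    have hwdeg : ∀ c, ∀ m ∈ (w c).support, m.degree + F.deg i c + 1 = j := by
      intro c m hm
      have hm' : Finsupp.single a 1 + m ∈ (F.diff i v c).support := by
        rw [mem_support_iff] at hm ⊢
        rwa [coeff_divMonomial] at hm
      have := forall_degree_map (F.diff i) (F.diff_graded i) (fun l => l = j) hv c _ hm'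
      rw [map_add, Finsupp.degree_single] at this
      omega
    by_cases hwb : ∃ y, ∀ c, w c - F.diff i y c ∈ tailIdeal k n (s + 1)
    · obtain ⟨z, hz, hzw⟩ : ∃ z, (∀ c, ∀ m ∈ (z c).support, m.degree + F.deg (i + 1) c + 1 = j) ∧
          ∀ c, w c - F.diff i z c ∈ tailIdeal k n (s + 1) := by
        rcases j with _ | j
        · refine ⟨0, by simp, fun c => ?_⟩
          have : w c = 0 := by
            rw [← support_eq_empty, Finset.eq_empty_iff_forall_notMem]
            intro m hm
            exact absurd (hwdeg c m hm) (by omega)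
          simp [this]
        · obtain ⟨y, hy⟩ := hwb
          obtain ⟨z, hz, hzw⟩ := exists_homogeneous_preimage (F.diff i) (F.diff_graded i)
            (w := w) (j := j) (fun c m hm => by have := hwdeg c m hm; omega) hy
          exact ⟨z, fun c m hm => by have := hz c m hm; omega, hzw⟩
      -- The connecting map kills the class, so it lifts: `v - X a • z` is a cycle modulo fewer
      -- variables.
      refine Exists.imp (fun m hm => ⟨hm.1, by have := hm.2.1; omega, by have := hm.2.2; omega⟩)
        (ih i j (v - (X a : MvPolynomial (Fin n) k) • z) ?_ ?_ ?_)
      · classical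
        intro c m hm
        rcases Finset.mem_union.1 (support_sub _ _ _ hm) with h | h
        · exact hv c m h
        · rw [Pi.smul_apply, smul_eq_mul, support_X_mul, Finset.mem_map] at h
          obtain ⟨m', hm', rfl⟩ := h
          have := hz c m' hm'
          simp only [addLeftEmbedding_apply, map_add, Finsupp.degree_single]
          omega
      · intro c
        have : F.diff i (v - (X a : MvPolynomial (Fin n) k) • z) c
            = X a * (w c - F.diff i z c) + u c := by
          rw [map_sub, map_smul, hdv]
          simp only [Pi.sub_apply, Pi.add_apply, Pi.smul_apply, smul_eq_mul]
          ring
        rw [this]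
        exact add_mem (Ideal.mul_mem_left _ _ (hzw c)) (hu c)
      · rintro ⟨y, hy⟩
        refine hbd ⟨y, fun c => ?_⟩
        have : v c - F.diff (i + 1) y c
            = ((v - (X a : MvPolynomial (Fin n) k) • z) c - F.diff (i + 1) y c) + X a * z c := by
          simp only [Pi.sub_apply, Pi.smul_apply, smul_eq_mul]
          ring
        rw [this]
        exact add_mem (tailIdeal_succ_le s (hy c))
          (Ideal.mul_mem_right _ _ (X_mem_tailIdeal a))
    · rcases j with _ | j
      · refine absurd ⟨0, fun c => ?_⟩ hwb
        have : w c = 0 := by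
          rw [← support_eq_empty, Finset.eq_empty_iff_forall_notMem]
          intro m hm
          exact absurd (hwdeg c m hm) (by omega)
        simp [this]
      have hwhom : IsHomogeneousVector (F.deg i) j w := fun c m hm => by
        have := hwdeg c m hm
        omega
      rcases i with _ | i
      · obtain ⟨m, hm, hmdeg, hmax⟩ := F.exists_generator_of_aug hL (a := a) hwhom hu
          (by rw [← hdv]; exact (F.exact_zero _).2 ⟨v, rfl⟩) hwb
        exact ⟨m, hm, hmdeg, hmax⟩
      · refine Exists.imp (fun m hm => ⟨hm.1, by have := hm.2.1; omega, by have := hm.2.2; omega⟩)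
          (ih i j w hwhom (fun c => mem_tailIdeal_of_X_mul_mem (a := a) ?_) hwb)
        -- Applying the differential to `X a • w + u` shows that `w` becomes a cycle once x_a is
        -- cancelled.
        have h0 := congrFun (F.diff_diff i v) c
        rw [hdv, map_add, map_smul] at h0
        simp only [Pi.add_apply, Pi.smul_apply, smul_eq_mul, Pi.zero_apply] at h0
        rw [eq_neg_of_add_eq_zero_left h0]
        exact neg_mem (map_mem_tailIdeal (F.diff i) hu c)

/-- By minimality boundaries vanish modulo all variables, whereas a basis vector has a coordinate 1.
-/
theorem basis_notMem (i : ℕ) (b : Fin (F.rank i)) :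
    ¬ ∃ y, ∀ c, (Pi.single b 1 : Fin (F.rank i) → MvPolynomial (Fin n) k) c - F.diff i y c
      ∈ tailIdeal k n 0 := by
  rintro ⟨y, hy⟩
  refine one_notMem_tailIdeal (k := k) (n := n) 0 ?_
  have hd := F.minimal i y b
  rw [← tailIdeal_zero] at hd
  simpa using add_mem (hy b) hd

/-- A nonzero Betti number `β (i + 1) j` of a lexicographic ideal comes from a minimal monomial
generator of degree `j - i` divisible by a variable of index at least `i + 1`. -/
theorem exists_generator_of_betti_pos (hL : IsLexIdeal L) {i j : ℕ}
    (h : 0 < F.betti (i + 1) j) :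
    ∃ m ∈ minimalMonomialGenerators L, m.degree + i = j ∧ i + 1 ≤ monomialMax m := by
  obtain ⟨b, hb⟩ := Finset.card_pos.1 h
  have hbj : F.deg (i + 1) b = j := (Finset.mem_filter.1 hb).2
  have hhom : IsHomogeneousVector (F.deg (i + 1)) j (Pi.single b (1 : MvPolynomial (Fin n) k)) := by
    intro c m hm
    by_cases hcb : c = b
    · subst hcb
      rw [Pi.single_eq_same, support_one, Finset.mem_singleton] at hm
      simp [hm, hbj]
    · simp [Pi.single_eq_of_ne hcb] at hm
  obtain ⟨m, hm, hdeg, hmax⟩ := F.exists_generator_of_homology hL (Nat.zero_le n) i j _ hhom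
    (fun c => tailIdeal_zero (k := k) (n := n) ▸ F.minimal i _ c) (F.basis_notMem (i + 1) b)
  exact ⟨m, hm, hdeg, by omega⟩

/-- The module `F 0` is generated in degree `0`. -/
theorem eq_zero_of_betti_zero_pos {j : ℕ} (h : 0 < F.betti 0 j) : j = 0 := by
  obtain ⟨b, hb⟩ := Finset.card_pos.1 h
  have hbj : F.deg 0 b = j := (Finset.mem_filter.1 hb).2
  by_contra hj
  obtain ⟨p, hp, hpa⟩ := F.aug_graded b
  refine F.basis_notMem 0 b (F.exists_sub_diff_mem_of_aug_eq_mk (mem_tailIdeal.2 ?_) hpa)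
  intro m hm
  have hdeg := degree_eq_of_isHomogeneous hp hm
  by_contra! hcon
  have : m = 0 := Finsupp.ext fun i => hcon i (Nat.zero_le _)
  rw [this, map_zero] at hdeg
  omega

end MinimalGradedFreeResolution

theorem mainTheorem7 {k : Type*} [Field k] {n : ℕ} (L : Ideal (MvPolynomial (Fin n) k))
    (hL : IsLexIdeal L) (F : MinimalGradedFreeResolution L) (i : ℕ)
    (h : AdmitsZeroCancellation F.betti i ∨ AdmitsNegativeCancellation F.betti i) :
    ∃ m ∈ minimalMonomialGenerators L, i - 1 ≤ monomialMax m ∧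
      ∃ m' ∈ minimalMonomialGenerators L, i ≤ monomialMax m' ∧ m'.degree < m.degree := by
  obtain ⟨hi, j, j', hjj', hj, hj'⟩ : 1 ≤ i ∧ ∃ j j' : ℕ, j ≤ j' ∧ 0 < F.betti i j ∧
      0 < F.betti (i - 1) j' := by
    rcases h with ⟨hi, j, j', hjj', hj, hj'⟩ | ⟨hi, j, j', hjj', hj, hj'⟩
    · exact ⟨hi, j, j', hjj'.le, hj, hj'⟩
    · exact ⟨hi, j, j', hjj'.le, hj, hj'⟩
  obtain ⟨i, rfl⟩ := Nat.exists_eq_add_of_le' hi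
  rw [Nat.add_sub_cancel] at hj' ⊢
  obtain ⟨m', hm', hdeg', hmax'⟩ := F.exists_generator_of_betti_pos hL hj
  rcases i with _ | i
  -- For i = 1, j' = 0 forces m' = 1, contradicting max(m') ≥ 1.
  · have hj0 := F.eq_zero_of_betti_zero_pos hj'
    have : m' = 0 := (Finsupp.degree_eq_zero_iff m').1 (by omega)
    simp [this, monomialMax] at hmax'
  · obtain ⟨m, hm, hdeg, hmax⟩ := F.exists_generator_of_betti_pos hL hj'
    exact ⟨m, hm, hmax, m', hm', hmax', by omega⟩
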